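/- **Model.** There are $C$ access points (APs) with $N_r$ antennas each, $K$ users (UEs) with $N_t$ antennas each, $Q$ RISs with $M$ elements each, and subcarriers $t\in\{-S/2,\dots,-1,1,\dots,S/2\}$; $\mathcal K_s$ is the set of UEs served on subcarrier $s$. For block channels $\mathbf G^t\in\mathbb C^{CN_r\times QM}$ (RISs to APs), $\mathbf H_k^t\in\mathbb C^{QM\times N_t}$ (UE $k$ to RISs), $\mathbf R_k^t\in\mathbb C^{CN_r\times N_t}$ (UE $k$ to APs) and a diagonal matrix $\boldsymbol\Theta$ of RIS coefficients $\rho e^{\iota\phi}$, all possibly random, put $\bar{\mathbf H}_k^t=\mathbf G^t\boldsymbol\Theta\mathbf H_k^t+\mathbf R_k^t$ and $\bar{\mathbf H}=(\bar{\mathbf H}_k^t)_{k,t}$. Here $^*$ denotes the entrywise complex conjugate, and $^H$ the conjugate transpose. The I/Q imbalance is given by real diagonal amplitude mismatches $\mathbf L_{r,c},\mathbf L_{t,k}$ and real phase vectors $\boldsymbol\psi_{r,c},\boldsymbol\psi_{t,k}$, through $$\mathbf K_1=\mathrm{diag}\Big(\big\{\tfrac12(\mathbf I+\mathbf L_{r,c}\odot\mathrm{diag}(e^{-\iota\boldsymbol\psi_{r,c}}))\big\}_{c=1}^C\Big),\quad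 \mathbf K_2=\mathbf I-\mathbf K_1^*,\quad \mathbf D_{1k}=\tfrac12(\mathbf I+\mathbf L_{t,k}\odot\mathrm{diag}(e^{\iota\boldsymbol\psi_{t,k}})),\quad \mathbf D_{2k}=\mathbf I-\mathbf D_{1k}^*,$$ $$\mathbf P_k^{1,s}=\mathbf K_1\bar{\mathbf H}_k^s\mathbf D_{1k}+\mathbf K_2(\bar{\mathbf H}_k^{-s})^*\mathbf D_{2k},\qquad \mathbf P_k^{2,s}=\mathbf K_2(\bar{\mathbf H}_k^{-s})^*\mathbf D_{1k}^*+\mathbf K_1\bar{\mathbf H}_k^s\mathbf D_{2k}^*.$$ With precoders $\mathbf V_i^t\in\mathbb C^{N_t\times b_i}$ that may depend (measurably) on $\bar{\mathbf H}$, the signal received on subcarrier $s$ by all APs, jointly available at the central processor, is $$\mathbf y^s=\sum_{i\in\mathcal K_s}\mathbf P_i^{1,s}\mathbf V_i^s\mathbf x_i^s+\sum_{i\in\mathcal K_s}\mathbf P_i^{2,s}(\mathbf V_i^{-s})^*(\mathbf x_i^{-s})^*+\mathbf K_1\mathbf n^s+\mathbf K_2(\mathbf n^s)^*.$$ **Assumptions.**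 Each symbol vector satisfies $\mathbf x_i^t\sim\mathcal{CN}(\mathbf 0,\mathbf I_{b_i})$, and $\mathbf n^s\sim\mathcal{CN}(\mathbf 0,\sigma^2\mathbf I_{CN_r})$ with $\sigma>0$. The family of all $\mathbf x_i^t$ together with $\mathbf n^s$ is independent of $\bar{\mathbf H}$. The interference, the cross-talk from subcarrier $-s$ and the noise are uncorrelated with each other and with the useful signal, in the sense that $\mathbb E[\mathbf x_i^t(\mathbf x_l^t)^H]=\mathbf 0$ for all $t$ and all $i\ne l$; $\mathbb E[\mathbf x_i^s(\mathbf x_l^{-s})^T]=\mathbf 0$ for all $i,l\in\mathcal K_s$; and $\mathbb E[\mathbf x_i^{t}(\mathbf n^s)^H]=\mathbb E[\mathbf x_i^{t}(\mathbf n^s)^T]=\mathbf 0$ for $i\in\mathcal K_s$, $t\in\{s,-s\}$. (Independence of these vectors, or joint Gaussianity, is not required.) **Claim.** Let $k\in\mathcal K_s$, $$\mathbf J_k^s=\sum_{i\in\mathcal K_s,\,i\ne k}\mathbf P_i^{1,s}\mathbf V_i^s\mathbf V_i^{sH}\mathbf P_i^{1,sH}+\sigma^2\mathbf K_1\mathbf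 K_1^H+\sigma^2\mathbf K_2\mathbf K_2^H+\sum_{i\in\mathcal K_s}\mathbf P_i^{2,s}(\mathbf V_i^{-s})^*(\mathbf V_i^{-s})^T\mathbf P_i^{2,sH}$$ and $$\mathrm{SE}_k^s=\log_2\det\big(\mathbf I_{b_k}+\mathbf V_k^{sH}\mathbf P_k^{1,sH}(\mathbf J_k^s)^{-1}\mathbf P_k^{1,s}\mathbf V_k^s\big).$$ Then $\mathbf J_k^s$ and the matrix inside the determinant are positive definite for every channel realization, and $\mathrm{SE}_k^s$ is an achievable rate for UE $k$ on subcarrier $s$ with fully centralized processing, in the sense that it is a lower bound for the mutual information (in bits) given the channels: for almost every realization $h$ of $\bar{\mathbf H}$, $$I(\mathbf x_k^s;\mathbf y^s\mid\bar{\mathbf H}=h)\ \ge\ \mathrm{SE}_k^s(h),$$ and consequently, on average over the channels, $I(\mathbf x_k^s;\mathbf y^s\mid\bar{\mathbf H})\ge\mathbb E[\mathrm{SE}_k^s(\bar{\mathbf H})]$. -/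

import Mathlib

open MeasureTheory ProbabilityTheory
open scoped ENNReal NNReal Matrix ComplexOrder

/-- Matrices carry the product sigma-algebra of their entries. -/
instance Matrix.instMeasurableSpaceEntries {m n α : Type*} [MeasurableSpace α] :
    MeasurableSpace (Matrix m n α) :=
  inferInstanceAs (MeasurableSpace (m → n → α))

noncomputable section

namespace CellFree

/-! ### Probabilistic notions -/

/-- The circularly symmetric complex Gaussian law `CN(0, v)` on `ℂ`: real and imaginary part are
independent, each with law `N(0, v / 2)`. -/
def circularGaussian (v : ℝ≥0) : Measure ℂ :=
  ((gaussianReal 0 (v / 2)).prod (gaussianReal 0 (v / 2))).map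
    fun p => (p.1 : ℂ) + (p.2 : ℂ) * Complex.I

/-- The circularly symmetric complex Gaussian law `CN(0, v I)` on `ℂ^ι`. -/
def circularGaussianVec (ι : Type*) [Fintype ι] (v : ℝ≥0) : Measure (ι → ℂ) :=
  Measure.pi fun _ => circularGaussian v

/-- `𝔼[X Yᴴ] = 0`. It is used for centred square integrable random vectors `X` and `Y` only. -/
def Uncorrelated {Ω ι κ : Type*} [MeasurableSpace Ω] (P : Measure Ω)
    (X : Ω → ι → ℂ) (Y : Ω → κ → ℂ) : Prop :=
  ∀ i j, ∫ ω, X ω i * star (Y ω j) ∂P = 0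

/-- Mutual information, in bits, of the two coordinates under a joint law `π`: the relative entropy
of `π` with respect to the product of its marginals. -/
def mutualInfoLaw {α β : Type*} [MeasurableSpace α] [MeasurableSpace β]
    (π : Measure (α × β)) : ℝ≥0∞ :=
  InformationTheory.klDiv π (π.fst.prod π.snd) / ENNReal.ofReal (Real.log 2)

section MutualInfo

variable {Ω α β γ : Type*} [MeasurableSpace Ω]
  [MeasurableSpace α] [StandardBorelSpace α] [Nonempty α]
  [MeasurableSpace β] [StandardBorelSpace β] [Nonempty β] [MeasurableSpace γ]

/-- `I(X; Y | Z = z)` in bits: the mutual information under the regular conditional law of `(X, Y)`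
given `Z = z`. -/
def mutualInfoGivenValue (P : Measure Ω) [IsFiniteMeasure P]
    (X : Ω → α) (Y : Ω → β) (Z : Ω → γ) (z : γ) : ℝ≥0∞ :=
  mutualInfoLaw (condDistrib (fun ω => (X ω, Y ω)) Z P z)

/-- The conditional mutual information `I(X; Y | Z)` in bits: the average of `I(X; Y | Z = z)` over
the law of `Z`. -/
def condMutualInfo (P : Measure Ω) [IsFiniteMeasure P]
    (X : Ω → α) (Y : Ω → β) (Z : Ω → γ) : ℝ≥0∞ :=
  ∫⁻ z, mutualInfoGivenValue P X Y Z z ∂(P.map Z)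

end MutualInfo

/-! ### Subcarriers, channels and hardware -/

/-- The subcarrier indices `-S/2, …, -1, 1, …, S/2`. -/
abbrev Subcarrier (S : ℕ) : Type := {t : ℤ // t ≠ 0 ∧ 2 * |t| ≤ (S : ℤ)}

instance (S : ℕ) : Neg (Subcarrier S) :=
  ⟨fun t => ⟨-t.1, neg_ne_zero.mpr t.2.1, by rw [abs_neg]; exact t.2.2⟩⟩

/-- Entrywise complex conjugate of a matrix. -/
def conjMat {m n : Type*} (A : Matrix m n ℂ) : Matrix m n ℂ := A.map star

/-- Entrywise complex conjugate of a random vector. -/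
def conjVec {Ω ι : Type*} (X : Ω → ι → ℂ) : Ω → ι → ℂ := fun ω i => star (X ω i)

section Model

variable {C K Q M Nr Nt S : ℕ}

/-- Vertical concatenation over the blocks. -/
def vstack {A B N : ℕ} (X : Fin A → Matrix (Fin B) (Fin N) ℂ) :
    Matrix (Fin A × Fin B) (Fin N) ℂ :=
  Matrix.of fun p n => X p.1 p.2 n

/-- The channels `G_{c,j}` from the RISs to the APs on one subcarrier as one block matrix. -/
def risToAp (G : Fin C → Fin Q → Matrix (Fin Nr) (Fin M) ℂ) :
    Matrix (Fin C × Fin Nr) (Fin Q × Fin M) ℂ :=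
  Matrix.of fun p q => G p.1 q.1 p.2 q.2

/-- The diagonal matrix of RIS coefficients `ρ_m^j exp(i φ_m^j)`. -/
def risMatrix (ρ φ : Fin Q → Fin M → ℝ) : Matrix (Fin Q × Fin M) (Fin Q × Fin M) ℂ :=
  Matrix.diagonal fun p => (ρ p.1 p.2 : ℂ) * Complex.exp (Complex.I * (φ p.1 p.2 : ℂ))

/-- The collection of the effective channels of all UEs on all subcarriers. -/
abbrev Channels (C K Nr Nt S : ℕ) : Type :=
  Fin K → Subcarrier S → Matrix (Fin C × Fin Nr) (Fin Nt) ℂ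

/-- The effective channels `H̄_k^t = G^t Θ H_k^t + R_k^t`; arguments of `G`, `H` and `R` are
`G t c j`, `H t j k` and `R t c k`. -/
def effectiveChannels
    (G : Subcarrier S → Fin C → Fin Q → Matrix (Fin Nr) (Fin M) ℂ)
    (H : Subcarrier S → Fin Q → Fin K → Matrix (Fin M) (Fin Nt) ℂ)
    (R : Subcarrier S → Fin C → Fin K → Matrix (Fin Nr) (Fin Nt) ℂ)
    (ρ φ : Fin Q → Fin M → ℝ) : Channels C K Nr Nt S :=
  fun k t => risToAp (G t) * risMatrix ρ φ * vstack (fun j => H t j k) + vstack (fun c => R t c k)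

/-- Amplitude and phase mismatches of the receivers (APs) and of the transmitters (UEs). -/
structure IQImbalance (C K Nr Nt : ℕ) where
  /-- diagonal of `L_{r,c}` -/
  rxAmp : Fin C → Fin Nr → ℝ
  /-- `ψ_{r,c}` -/
  rxPhase : Fin C → Fin Nr → ℝ
  /-- diagonal of `L_{t,k}` -/
  txAmp : Fin K → Fin Nt → ℝ
  /-- `ψ_{t,k}` -/
  txPhase : Fin K → Fin Nt → ℝ

namespace IQImbalance

variable (q : IQImbalance C K Nr Nt)

/-- `K_{1c} = (I + L_{r,c} ⊙ diag(exp(-i ψ_{r,c}))) / 2`. -/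
def K₁c (c : Fin C) : Matrix (Fin Nr) (Fin Nr) ℂ :=
  (1 / 2 : ℂ) • (1 + (Matrix.diagonal fun r => (q.rxAmp c r : ℂ)) ⊙
    (Matrix.diagonal fun r => Complex.exp (-Complex.I * (q.rxPhase c r : ℂ))))

/-- `K_1 = diag(K_{11}, …, K_{1C})`, block diagonal. -/
def K₁ : Matrix (Fin C × Fin Nr) (Fin C × Fin Nr) ℂ :=
  Matrix.of fun p p' => if p.1 = p'.1 then q.K₁c p.1 p.2 p'.2 else 0

/-- `K_2 = I - K_1^*`. -/
def K₂ : Matrix (Fin C × Fin Nr) (Fin C × Fin Nr) ℂ := 1 - conjMat q.K₁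

/-- `D_{1k} = (I + L_{t,k} ⊙ diag(exp(i ψ_{t,k}))) / 2`. -/
def D₁ (k : Fin K) : Matrix (Fin Nt) (Fin Nt) ℂ :=
  (1 / 2 : ℂ) • (1 + (Matrix.diagonal fun r => (q.txAmp k r : ℂ)) ⊙
    (Matrix.diagonal fun r => Complex.exp (Complex.I * (q.txPhase k r : ℂ))))

/-- `D_{2k} = I - D_{1k}^*`. -/
def D₂ (k : Fin K) : Matrix (Fin Nt) (Fin Nt) ℂ := 1 - conjMat (q.D₁ k)

/-- `P_k^{1,s} = K_1 H̄_k^s D_{1k} + K_2 (H̄_k^{-s})^* D_{2k}`. -/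
def P₁ (h : Channels C K Nr Nt S) (k : Fin K) (s : Subcarrier S) :
    Matrix (Fin C × Fin Nr) (Fin Nt) ℂ :=
  q.K₁ * h k s * q.D₁ k + q.K₂ * conjMat (h k (-s)) * q.D₂ k

/-- `P_k^{2,s} = K_2 (H̄_k^{-s})^* D_{1k}^* + K_1 H̄_k^s D_{2k}^*`. -/
def P₂ (h : Channels C K Nr Nt S) (k : Fin K) (s : Subcarrier S) :
    Matrix (Fin C × Fin Nr) (Fin Nt) ℂ :=
  q.K₂ * conjMat (h k (-s)) * conjMat (q.D₁ k) + q.K₁ * h k s * conjMat (q.D₂ k)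

variable {b : Fin K → ℕ}

/-- The signal received on subcarrier `s` by all APs, for channels `h`, precoders `V`, symbols `x`
and noise `n`; `𝒦 s` is the set of the UEs served on `s`. -/
def received (𝒦 : Subcarrier S → Finset (Fin K)) (s : Subcarrier S) (h : Channels C K Nr Nt S)
    (V : ∀ i : Fin K, Subcarrier S → Matrix (Fin Nt) (Fin (b i)) ℂ)
    (x : ∀ i : Fin K, Subcarrier S → Fin (b i) → ℂ) (n : Fin C × Fin Nr → ℂ) :
    Fin C × Fin Nr → ℂ :=
  ∑ i ∈ 𝒦 s, (q.P₁ h i s * V i s) *ᵥ x i s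
    + ∑ i ∈ 𝒦 s, (q.P₂ h i s * conjMat (V i (-s))) *ᵥ star (x i (-s))
    + q.K₁ *ᵥ n + q.K₂ *ᵥ star n

/-- The interference-plus-impairment-and-noise covariance `J_k^s`, noise variance `σ²`. -/
def J (𝒦 : Subcarrier S → Finset (Fin K)) (σ : ℝ≥0) (k : Fin K) (s : Subcarrier S)
    (h : Channels C K Nr Nt S) (V : ∀ i : Fin K, Subcarrier S → Matrix (Fin Nt) (Fin (b i)) ℂ) :
    Matrix (Fin C × Fin Nr) (Fin C × Fin Nr) ℂ :=
  ∑ i ∈ (𝒦 s).erase k, q.P₁ h i s * V i s * (V i s)ᴴ * (q.P₁ h i s)ᴴ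
    + (((σ : ℝ) : ℂ) ^ 2) • (q.K₁ * q.K₁ᴴ) + (((σ : ℝ) : ℂ) ^ 2) • (q.K₂ * q.K₂ᴴ)
    + ∑ i ∈ 𝒦 s,
        q.P₂ h i s * conjMat (V i (-s)) * (V i (-s))ᵀ * (q.P₂ h i s)ᴴ

/-- `I + V_k^{sᴴ} P_k^{1,sᴴ} (J_k^s)⁻¹ P_k^{1,s} V_k^s`. -/
def rateMatrix (𝒦 : Subcarrier S → Finset (Fin K)) (σ : ℝ≥0) (k : Fin K) (s : Subcarrier S)
    (h : Channels C K Nr Nt S) (V : ∀ i : Fin K, Subcarrier S → Matrix (Fin Nt) (Fin (b i)) ℂ) :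
    Matrix (Fin (b k)) (Fin (b k)) ℂ :=
  1 + (V k s)ᴴ * (q.P₁ h k s)ᴴ * (q.J 𝒦 σ k s h V)⁻¹ * q.P₁ h k s * V k s

/-- `SE_k^s`, the base two logarithm of the (real) determinant of the rate matrix. -/
def SE (𝒦 : Subcarrier S → Finset (Fin K)) (σ : ℝ≥0) (k : Fin K) (s : Subcarrier S)
    (h : Channels C K Nr Nt S) (V : ∀ i : Fin K, Subcarrier S → Matrix (Fin Nt) (Fin (b i)) ℂ) :
    ℝ :=
  Real.logb 2 (q.rateMatrix 𝒦 σ k s h V).det.re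

end IQImbalance

end Model

end CellFree

end

/-! For a fixed channel the received vector is `A x + W`, where `x ∼ CN(0, I)`, `A = P₁ V`, and `W`
collects interference, mirror cross-talk and noise. `W` need be neither Gaussian nor independent of
`x`; only `𝔼[x Wᴴ] = 0` and `𝔼[W Wᴴ] = J` are known. That suffices because relative entropy is
bounded below by `∫ f dμ` for every test function `f` with `∫ exp f dν = 1`
(`InformationTheory.ofReal_integral_le_klDiv`), and `f` can be chosen quadratic.

Put `M = I + Aᴴ J⁻¹ A` and `B = M⁻¹ Aᴴ J⁻¹`, the linear MMSE estimator. Take `f(x, y)` to be the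
log-ratio of the densities of `CN(B y, M⁻¹)` and `CN(0, I)` at `x`; this would be the true
posterior-to-prior ratio if `W` were Gaussian and independent of `x`. For each `y`, `exp f`
integrates to one over the prior (`lintegral_gaussian_density_ratio`), hence over the product of the
marginals. Under the joint law the mean of `f` is `log det M - tr(M 𝔼[Z Zᴴ]) + tr I` with error `Z =
x - B y`. Since `𝔼[Z Zᴴ] = M⁻¹` (`secondMoment_lmmse_error`), the traces cancel and `log det M`
remains: this is `ofReal_logb_det_le_mutualInfoLaw`.

Two facts connect this to the model. The uncorrelatedness assumptions and the circularity of the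
noise remove all cross terms, so `W` has covariance `J` (`secondMoment_disturbance`). Independence
of the symbols and noise from the channels makes the conditional law given `h` the law with the
channel frozen at `h` (`condDistrib_comp_of_indepFun`). Averaging the pointwise bound gives the last
claim. -/

/-! ### Relative entropy and product densities. -/

/-- **Gibbs variational bound**: a function `f` whose exponential has integral one with respect to
`ν` gives a lower bound of the relative entropy. -/
theorem InformationTheory.ofReal_integral_le_klDiv {α : Type*} [MeasurableSpace α]
    {μ ν : Measure α} [IsProbabilityMeasure μ] [IsProbabilityMeasure ν] {f : α → ℝ}
    (hf : Measurable f) (hfμ : Integrable f μ)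
    (hfν : ∫⁻ a, ENNReal.ofReal (Real.exp (f a)) ∂ν = 1) :
    ENNReal.ofReal (∫ a, f a ∂μ) ≤ klDiv μ ν := by
  by_cases htop : klDiv μ ν = ∞
  · simp [htop]
  obtain ⟨hac, hint⟩ := klDiv_ne_top_iff.mp htop
  have hexp : Integrable (fun a => Real.exp (f a)) ν := by
    refine ⟨(Real.measurable_exp.comp hf).aestronglyMeasurable, ?_⟩
    rw [hasFiniteIntegral_iff_ofReal (ae_of_all _ fun a => (Real.exp_pos _).le), hfν]
    exact ENNReal.one_lt_top
  have hone : ∫ a, Real.exp (f a) ∂ν = 1 := by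
    rw [integral_eq_lintegral_of_nonneg_ae (ae_of_all _ fun a => (Real.exp_pos _).le)
      hexp.aestronglyMeasurable, hfν, ENNReal.toReal_one]
  -- Tilting `ν` by `f` gives a probability measure, and the divergence of `μ` from it is `∫ llr μ ν
  -- dμ - ∫ f dμ + log ∫ exp f dν`, whose last term is zero here. Nonnegativity of that divergence
  -- is the claim.
  have hprob := isProbabilityMeasure_tilted hexp
  have h := integral_llr_tilted_right hac hfμ hexp hint
  have hnn : 0 ≤ ∫ a, llr μ (ν.tilted f) a ∂μ := by
    rw [← toReal_klDiv_of_measure_eq (hac.trans (absolutelyContinuous_tilted hexp)) (by simp)]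
    exact ENNReal.toReal_nonneg
  rw [h, hone, Real.log_one, add_zero] at hnn
  rw [← ENNReal.ofReal_toReal htop, toReal_klDiv_of_measure_eq hac (by simp)]
  exact ENNReal.ofReal_le_ofReal (by linarith)

/-- A product of measures with integrable densities has the product density. -/
theorem MeasureTheory.Measure.pi_withDensity_ofReal {ι : Type*} [Fintype ι] {E : ι → Type*}
    [∀ i, MeasurableSpace (E i)] (μ : ∀ i, Measure (E i)) [∀ i, SigmaFinite (μ i)]
    (r : ∀ i, E i → ℝ) (hr : ∀ i, Integrable (r i) (μ i)) (hnn : ∀ i a, 0 ≤ r i a) :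
    Measure.pi (fun i => (μ i).withDensity fun a => ENNReal.ofReal (r i a)) =
      (Measure.pi μ).withDensity fun a => ENNReal.ofReal (∏ i, r i (a i)) := by
  have (i : ι) : IsFiniteMeasure ((μ i).withDensity fun a => ENNReal.ofReal (r i a)) :=
    isFiniteMeasure_withDensity_ofReal (hr i).2
  refine (Measure.pi_eq fun s hs => ?_)
  rw [withDensity_apply _ (MeasurableSet.univ_pi hs), Measure.restrict_pi_pi,
    ← ofReal_integral_eq_lintegral_ofReal
      (Integrable.fintype_prod_dep fun i => (hr i).restrict)
      (ae_of_all _ fun a => Finset.prod_nonneg fun i _ => hnn i _),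
    integral_fintype_prod_eq_prod (𝕜 := ℝ) (fun i a => r i a),
    ENNReal.ofReal_prod_of_nonneg fun i _ => integral_nonneg (hnn i)]
  refine Finset.prod_congr rfl fun i _ => ?_
  rw [withDensity_apply _ (hs i), ofReal_integral_eq_lintegral_ofReal (hr i).restrict
    (ae_of_all _ (hnn i))]

/-! ### Densities of complex Gaussian vectors. -/

namespace CellFree

instance (v : ℝ≥0) : IsProbabilityMeasure (circularGaussian v) :=
  Measure.isProbabilityMeasure_map (by fun_prop)

instance (ι : Type*) [Fintype ι] (v : ℝ≥0) : IsProbabilityMeasure (circularGaussianVec ι v) := by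
  unfold circularGaussianVec; infer_instance

/-- The density of `CN(0, 1)`. -/
theorem circularGaussian_one_eq_withDensity :
    circularGaussian 1 =
      volume.withDensity fun z => ENNReal.ofReal (Real.pi⁻¹ * Real.exp (-‖z‖ ^ 2)) := by
  have hpdf : ∀ a b : ℝ, gaussianPDF 0 (1 / 2) a * gaussianPDF 0 (1 / 2) b =
      ENNReal.ofReal (Real.pi⁻¹ * Real.exp (-(a ^ 2 + b ^ 2))) := by
    intro a b
    rw [gaussianPDF, gaussianPDF, ← ENNReal.ofReal_mul (gaussianPDFReal_nonneg _ _ _),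
      gaussianPDFReal, gaussianPDFReal]
    congr 1
    have h2 : (2 * Real.pi * ((1 / 2 : ℝ≥0) : ℝ)) = Real.pi := by push_cast; ring
    have h3 : Real.sqrt Real.pi * Real.sqrt Real.pi = Real.pi := Real.mul_self_sqrt Real.pi_pos.le
    rw [h2, mul_mul_mul_comm, ← mul_inv, h3, ← Real.exp_add]
    congr 2
    push_cast
    ring
  have hmap : (fun p : ℝ × ℝ => (p.1 : ℂ) + (p.2 : ℂ) * Complex.I) =
      Complex.measurableEquivRealProd.symm := by
    ext p
    rw [Complex.measurableEquivRealProd_symm_apply, Complex.mk_eq_add_mul_I]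
  have hvp := Complex.volume_preserving_equiv_real_prod.symm
  rw [circularGaussian, gaussianReal_of_var_ne_zero _ (by simp),
    prod_withDensity (by fun_prop) (by fun_prop), hmap]
  ext s hs
  rw [Measure.map_apply hvp.measurable hs, withDensity_apply _ hs,
    withDensity_apply _ (hvp.measurable hs), ← hvp.setLIntegral_comp_preimage_emb
      (MeasurableEquiv.measurableEmbedding _)]
  refine lintegral_congr fun p => ?_
  rw [hpdf, ← hmap, ← Complex.normSq_eq_norm_sq, Complex.normSq_add_mul_I]

/-- The density of `CN(0, I)`. -/
theorem circularGaussianVec_one_eq_withDensity (ι : Type*) [Fintype ι] :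
    circularGaussianVec ι 1 = volume.withDensity fun z : ι → ℂ =>
      ENNReal.ofReal (∏ i, Real.pi⁻¹ * Real.exp (-‖z i‖ ^ 2)) := by
  have hint : Integrable (fun z : ℂ => Real.pi⁻¹ * Real.exp (-‖z‖ ^ 2)) := by
    refine ⟨by fun_prop, ?_⟩
    rw [hasFiniteIntegral_iff_ofReal (ae_of_all _ fun a => by positivity), ← setLIntegral_univ,
      ← withDensity_apply _ MeasurableSet.univ, ← circularGaussian_one_eq_withDensity]
    exact measure_lt_top _ _
  rw [circularGaussianVec, circularGaussian_one_eq_withDensity, volume_pi,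
    Measure.pi_withDensity_ofReal _ _ (fun _ => hint) fun _ _ => by positivity]

/-- The complex linear change of variables in the Lebesgue measure of `ℂ^ι`. -/
theorem lintegral_comp_mulVec {ι : Type*} [Fintype ι] [DecidableEq ι] (L : Matrix ι ι ℂ)
    (hL : L.det ≠ 0) {g : (ι → ℂ) → ℝ≥0∞} (hg : Measurable g) :
    ∫⁻ z, g (L *ᵥ z) = ENNReal.ofReal (‖L.det‖ ^ 2)⁻¹ * ∫⁻ z, g z := by
  -- Lebesgue measure scales by the real determinant, which for a complex linear map is the norm
  -- from `ℂ` to `ℝ` of the complex determinant, that is `|det L|²`.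
  set f : (ι → ℂ) →ₗ[ℝ] (ι → ℂ) := (Matrix.toLin' L).restrictScalars ℝ
  have hdet : LinearMap.det f = ‖L.det‖ ^ 2 := by
    rw [LinearMap.det_restrictScalars, LinearMap.det_toLin', Algebra.norm_complex_apply,
      Complex.normSq_eq_norm_sq]
  have hmap := Measure.map_linearMap_addHaar_eq_smul_addHaar (volume : Measure (ι → ℂ)) (f := f)
    (by rw [hdet]; positivity)
  have hf : Measurable f := (LinearMap.continuous_of_finiteDimensional f).measurable
  calc ∫⁻ z, g (L *ᵥ z) = ∫⁻ z, g z ∂(Measure.map f volume) := (lintegral_map hg hf).symm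
    _ = _ := by
      rw [hmap, lintegral_smul_measure, hdet, abs_of_nonneg (by positivity), smul_eq_mul]

-- The factor `L` turns the quadratic form of `M` into `‖L u‖²`, so that a Gaussian integral with
-- precision matrix `M` reduces to the standard one by a linear substitution. It exists because
-- nonnegative elements of a C⋆-algebra have the form `star a * a`.
open scoped MatrixOrder Matrix.Norms.L2Operator in
theorem exists_eq_conjTranspose_mul_self {ι : Type*} [Fintype ι] [DecidableEq ι]
    {M : Matrix ι ι ℂ} (hM : M.PosDef) : ∃ L : Matrix ι ι ℂ, M = Lᴴ * L :=
  CStarAlgebra.nonneg_iff_eq_star_mul_self.mp hM.posSemidef.nonneg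

/-- The conditional Gaussian density `x ↦ CN(m, M⁻¹)(x)` relative to `CN(0, I)` integrates to
one. -/
theorem lintegral_gaussian_density_ratio {ι : Type*} [Fintype ι] [DecidableEq ι]
    {M : Matrix ι ι ℂ} (hM : M.PosDef) (m : ι → ℂ) :
    ∫⁻ z, ENNReal.ofReal (Real.exp (Real.log M.det.re
      - (star (z - m) ⬝ᵥ (M *ᵥ (z - m))).re + ∑ i, ‖z i‖ ^ 2)) ∂(circularGaussianVec ι 1) = 1 := by
  obtain ⟨L, hLM⟩ := exists_eq_conjTranspose_mul_self hM
  have hdetM : M.det = ((‖L.det‖ ^ 2 : ℝ) : ℂ) := by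
    rw [hLM, Matrix.det_mul, Matrix.det_conjTranspose, Complex.ofReal_pow]
    exact Complex.conj_mul' _
  have hL : L.det ≠ 0 := by
    intro h
    have := hM.det_pos
    simp [hdetM, h] at this
  have hq : ∀ u : ι → ℂ, (star u ⬝ᵥ (M *ᵥ u)).re = ∑ i, ‖(L *ᵥ u) i‖ ^ 2 := by
    intro u
    rw [hLM, ← Matrix.mulVec_mulVec, Matrix.dotProduct_mulVec, Matrix.vecMul_conjTranspose,
      star_star, dotProduct, Complex.re_sum]
    refine Finset.sum_congr rfl fun i _ => ?_
    rw [Pi.star_apply, ← Complex.normSq_eq_norm_sq, Complex.star_def, mul_comm, Complex.mul_conj,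
      Complex.ofReal_re]
  have hmeas : Measurable fun z : ι → ℂ =>
      ENNReal.ofReal (∏ i, Real.pi⁻¹ * Real.exp (-‖z i‖ ^ 2)) := by fun_prop
  have hone : ∫⁻ z : ι → ℂ, ENNReal.ofReal (∏ i, Real.pi⁻¹ * Real.exp (-‖z i‖ ^ 2)) = 1 := by
    rw [← setLIntegral_univ, ← withDensity_apply _ MeasurableSet.univ,
      ← circularGaussianVec_one_eq_withDensity, measure_univ]
  rw [circularGaussianVec_one_eq_withDensity,
    lintegral_withDensity_eq_lintegral_mul₀ hmeas.aemeasurable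
      (by simp only [hq]; refine Measurable.aemeasurable ?_; unfold Matrix.mulVec dotProduct; fun_prop)]
  -- The prior density cancels the factor `exp ‖z‖²`; what remains is `|det L|²` times the standard
  -- density at `L (z - m)`. Translation invariance and the substitution by `L` then give one.
  have hpt : ∀ z : ι → ℂ, ((fun z : ι → ℂ =>
      ENNReal.ofReal (∏ i, Real.pi⁻¹ * Real.exp (-‖z i‖ ^ 2))) * fun z =>
        ENNReal.ofReal (Real.exp (Real.log M.det.re
          - (star (z - m) ⬝ᵥ (M *ᵥ (z - m))).re + ∑ i, ‖z i‖ ^ 2))) z =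
      ENNReal.ofReal (‖L.det‖ ^ 2) *
        (fun u => ENNReal.ofReal (∏ i, Real.pi⁻¹ * Real.exp (-‖(L *ᵥ u) i‖ ^ 2))) (z - m) := by
    intro z
    simp only [Pi.mul_apply]
    rw [← ENNReal.ofReal_mul (by positivity), ← ENNReal.ofReal_mul (by positivity), hq,
      Finset.prod_mul_distrib, Finset.prod_mul_distrib, ← Real.exp_sum, ← Real.exp_sum, hdetM,
      Complex.ofReal_re, Real.exp_add, Real.exp_sub, Real.exp_log (by positivity),
      Finset.sum_neg_distrib, Finset.sum_neg_distrib, Real.exp_neg, Real.exp_neg]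
    congr 1
    have := (Real.exp_pos (∑ i, ‖z i‖ ^ 2)).ne'
    field_simp
  rw [lintegral_congr hpt, lintegral_const_mul' _ _ ENNReal.ofReal_ne_top,
    lintegral_sub_right_eq_self (fun u : ι → ℂ =>
      ENNReal.ofReal (∏ i, Real.pi⁻¹ * Real.exp (-‖(L *ᵥ u) i‖ ^ 2))) m,
    lintegral_comp_mulVec L hL hmeas, hone, mul_one, ← ENNReal.ofReal_mul (by positivity),
    mul_inv_cancel₀ (by positivity), ENNReal.ofReal_one]

end CellFree

/-! ### Calculus of mixed second moments. -/

namespace CellFree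

variable {Ω ι κ μ ν : Type*} [MeasurableSpace Ω] {P : Measure Ω}

/-- All entries of a random vector are square integrable. -/
def SquareIntegrable (P : Measure Ω) (X : Ω → ι → ℂ) : Prop :=
  ∀ i, MemLp (fun ω => X ω i) 2 P

/-- The matrix `𝔼[X Yᴴ]` of mixed second moments. -/
noncomputable def secondMoment (P : Measure Ω) (X : Ω → ι → ℂ) (Y : Ω → κ → ℂ) : Matrix ι κ ℂ :=
  Matrix.of fun i j => ∫ ω, X ω i * star (Y ω j) ∂P

theorem Uncorrelated.secondMoment_eq_zero {X : Ω → ι → ℂ} {Y : Ω → κ → ℂ}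
    (h : Uncorrelated P X Y) : secondMoment P X Y = 0 := by
  ext i j
  exact h i j

theorem conjTranspose_secondMoment (X : Ω → ι → ℂ) (Y : Ω → κ → ℂ) :
    (secondMoment P X Y)ᴴ = secondMoment P Y X := by
  ext i j
  simp only [secondMoment, Matrix.conjTranspose_apply, Matrix.of_apply, Complex.star_def]
  rw [← integral_conj]
  refine integral_congr_ae (ae_of_all _ fun ω => ?_)
  simp [mul_comm]

theorem secondMoment_swap_eq_zero {X : Ω → ι → ℂ} {Y : Ω → κ → ℂ} (h : secondMoment P X Y = 0) :
    secondMoment P Y X = 0 := by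
  rw [← conjTranspose_secondMoment, h, Matrix.conjTranspose_zero]

theorem secondMoment_conjVec_conjVec (X : Ω → ι → ℂ) (Y : Ω → κ → ℂ) :
    secondMoment P (conjVec X) (conjVec Y) = conjMat (secondMoment P X Y) := by
  ext i j
  simp only [secondMoment, conjMat, conjVec, Matrix.map_apply, Matrix.of_apply, Complex.star_def]
  rw [← integral_conj]
  simp

namespace SquareIntegrable

theorem conjVec {X : Ω → ι → ℂ} (hX : SquareIntegrable P X) : SquareIntegrable P (conjVec X) :=
  fun i => (hX i).star

theorem add {X Y : Ω → ι → ℂ} (hX : SquareIntegrable P X) (hY : SquareIntegrable P Y) :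
    SquareIntegrable P (fun ω => X ω + Y ω) :=
  fun i => (hX i).add (hY i)

theorem mulVec [Fintype ι] {X : Ω → ι → ℂ} (hX : SquareIntegrable P X) (A : Matrix κ ι ℂ) :
    SquareIntegrable P (fun ω => A *ᵥ X ω) :=
  fun i => memLp_finsetSum _ fun j _ => (hX j).const_mul (A i j)

theorem sum {α : Type*} {X : α → Ω → ι → ℂ} {s : Finset α}
    (hX : ∀ a ∈ s, SquareIntegrable P (X a)) :
    SquareIntegrable P (fun ω => ∑ a ∈ s, X a ω) := by
  intro i
  simp only [Finset.sum_apply]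
  exact memLp_finsetSum _ fun a ha => hX a ha i

theorem aemeasurable [Countable ι] {X : Ω → ι → ℂ} (hX : SquareIntegrable P X) :
    AEMeasurable X P :=
  aemeasurable_pi_lambda _ fun i => (hX i).aestronglyMeasurable.aemeasurable

theorem integrable_mul_star {X : Ω → ι → ℂ} {Y : Ω → κ → ℂ} (hX : SquareIntegrable P X)
    (hY : SquareIntegrable P Y) (i : ι) (j : κ) : Integrable (fun ω => X ω i * star (Y ω j)) P :=
  (hX i).integrable_mul (hY j).star

end SquareIntegrable

theorem secondMoment_add_left {X X' : Ω → ι → ℂ} {Y : Ω → κ → ℂ} (hX : SquareIntegrable P X)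
    (hX' : SquareIntegrable P X') (hY : SquareIntegrable P Y) :
    secondMoment P (fun ω => X ω + X' ω) Y = secondMoment P X Y + secondMoment P X' Y := by
  ext i j
  simp only [secondMoment, Matrix.of_apply, Matrix.add_apply, Pi.add_apply, add_mul]
  exact integral_add (hX.integrable_mul_star hY i j) (hX'.integrable_mul_star hY i j)

theorem secondMoment_add_right {X : Ω → ι → ℂ} {Y Y' : Ω → κ → ℂ} (hX : SquareIntegrable P X)
    (hY : SquareIntegrable P Y) (hY' : SquareIntegrable P Y') :
    secondMoment P X (fun ω => Y ω + Y' ω) = secondMoment P X Y + secondMoment P X Y' := by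
  rw [← conjTranspose_secondMoment, secondMoment_add_left hY hY' hX, Matrix.conjTranspose_add,
    conjTranspose_secondMoment, conjTranspose_secondMoment]

theorem secondMoment_sum_left {α : Type*} {X : α → Ω → ι → ℂ} {Y : Ω → κ → ℂ} {s : Finset α}
    (hX : ∀ a ∈ s, SquareIntegrable P (X a)) (hY : SquareIntegrable P Y) :
    secondMoment P (fun ω => ∑ a ∈ s, X a ω) Y = ∑ a ∈ s, secondMoment P (X a) Y := by
  ext i j
  simp only [secondMoment, Matrix.of_apply, Matrix.sum_apply, Finset.sum_apply, Finset.sum_mul]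
  exact integral_finsetSum _ fun a ha => (hX a ha).integrable_mul_star hY i j

theorem secondMoment_mulVec_left [Fintype ι] {X : Ω → ι → ℂ} {Y : Ω → κ → ℂ}
    (hX : SquareIntegrable P X) (hY : SquareIntegrable P Y) (A : Matrix μ ι ℂ) :
    secondMoment P (fun ω => A *ᵥ X ω) Y = A * secondMoment P X Y := by
  ext i j
  simp only [secondMoment, Matrix.of_apply, Matrix.mul_apply, Matrix.mulVec, dotProduct,
    Finset.sum_mul, mul_assoc]
  rw [integral_finsetSum _ fun l _ => (hX.integrable_mul_star hY l j).const_mul _]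
  simp only [integral_const_mul]

theorem secondMoment_mulVec_right [Fintype κ] {X : Ω → ι → ℂ} {Y : Ω → κ → ℂ}
    (hX : SquareIntegrable P X) (hY : SquareIntegrable P Y) (B : Matrix μ κ ℂ) :
    secondMoment P X (fun ω => B *ᵥ Y ω) = secondMoment P X Y * Bᴴ := by
  rw [← conjTranspose_secondMoment, secondMoment_mulVec_left hY hX, Matrix.conjTranspose_mul,
    conjTranspose_secondMoment]

theorem secondMoment_mulVec_mulVec [Fintype ι] [Fintype κ] {X : Ω → ι → ℂ} {Y : Ω → κ → ℂ}
    (hX : SquareIntegrable P X) (hY : SquareIntegrable P Y) (A : Matrix μ ι ℂ)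
    (B : Matrix ν κ ℂ) :
    secondMoment P (fun ω => A *ᵥ X ω) (fun ω => B *ᵥ Y ω) = A * secondMoment P X Y * Bᴴ := by
  rw [secondMoment_mulVec_left hX (hY.mulVec B), secondMoment_mulVec_right hX hY,
    Matrix.mul_assoc]

/-- The quadratic form of a matrix has expectation `tr (M 𝔼[X Xᴴ])`. -/
theorem integral_quadraticForm [Fintype ι] {X : Ω → ι → ℂ} (hX : SquareIntegrable P X)
    (M : Matrix ι ι ℂ) :
    ∫ ω, star (X ω) ⬝ᵥ (M *ᵥ X ω) ∂P = (M * secondMoment P X X).trace := by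
  have hint := (hX.mulVec M).integrable_mul_star hX
  rw [← secondMoment_mulVec_left hX hX, Matrix.trace]
  simp only [dotProduct, Matrix.diag_apply, secondMoment, Matrix.of_apply]
  rw [← integral_finsetSum _ fun i _ => hint i i]
  refine integral_congr_ae (ae_of_all _ fun ω => ?_)
  simp [mul_comm]

theorem integrable_quadraticForm [Fintype ι] {X : Ω → ι → ℂ} (hX : SquareIntegrable P X)
    (M : Matrix ι ι ℂ) : Integrable (fun ω => star (X ω) ⬝ᵥ (M *ᵥ X ω)) P := by
  simp only [dotProduct]
  refine integrable_finsetSum _ fun i _ => ?_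
  refine ((hX.mulVec M).integrable_mul_star hX i i).congr (ae_of_all _ fun ω => ?_)
  simp [mul_comm]

/-! ### Moments of circularly symmetric Gaussian vectors -/

theorem memLp_id_circularGaussian (v : ℝ≥0) : MemLp (fun z : ℂ => z) 2 (circularGaussian v) := by
  have h : MemLp (fun a : ℝ => (a : ℂ)) 2 (gaussianReal 0 (v / 2)) :=
    (memLp_id_gaussianReal' 2 (by simp)).ofReal
  rw [circularGaussian, memLp_map_measure_iff (by fun_prop) (by fun_prop)]
  have h1 := h.comp_fst (gaussianReal 0 (v / 2))
  have h2 := (h.comp_snd (gaussianReal 0 (v / 2))).mul_const Complex.I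
  exact h1.add h2

theorem integral_circularGaussian (v : ℝ≥0) : ∫ z, z ∂(circularGaussian v) = 0 := by
  have h : Integrable (fun a : ℝ => (a : ℂ)) (gaussianReal 0 (v / 2)) :=
    ((memLp_id_gaussianReal' 1 (by simp)).integrable le_rfl).ofReal
  rw [circularGaussian, integral_map (by fun_prop) (by fun_prop),
    integral_add (h.comp_fst _) ((h.comp_snd _).mul_const Complex.I),
    integral_mul_const, integral_fun_fst (fun a : ℝ => (a : ℂ)),
    integral_fun_snd (fun a : ℝ => (a : ℂ)), integral_complex_ofReal]
  simp

theorem integral_sq_gaussianReal_zero (v : ℝ≥0) : ∫ a, a ^ 2 ∂(gaussianReal 0 v) = v := by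
  have h := variance_fun_id_gaussianReal (μ := 0) (v := v)
  rwa [variance_of_integral_eq_zero (by fun_prop) (by simp)] at h

/-- Real and imaginary parts are independent and centred with equal variance `v / 2`: in `z²` the
squares cancel and the cross term has mean zero, while in `|z|²` the two variances add. -/
theorem integral_mul_circularGaussian (v : ℝ≥0) :
    ∫ z, z * z ∂(circularGaussian v) = 0 ∧ ∫ z, z * star z ∂(circularGaussian v) = v := by
  set g := gaussianReal 0 (v / 2)
  have h2 : MemLp (fun a : ℝ => a) 2 g := memLp_id_gaussianReal' 2 (by simp)
  have hsq : Integrable (fun a : ℝ => ((a ^ 2 : ℝ) : ℂ)) g := h2.integrable_sq.ofReal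
  have h1 : Integrable (fun a : ℝ => (a : ℂ)) g := (h2.integrable (by norm_num)).ofReal
  have hfst : ∫ p : ℝ × ℝ, ((p.1 ^ 2 : ℝ) : ℂ) ∂(g.prod g) = ((v / 2 : ℝ) : ℂ) := by
    rw [integral_fun_fst (fun a : ℝ => ((a ^ 2 : ℝ) : ℂ)), integral_complex_ofReal,
      integral_sq_gaussianReal_zero]
    simp
  have hsnd : ∫ p : ℝ × ℝ, ((p.2 ^ 2 : ℝ) : ℂ) ∂(g.prod g) = ((v / 2 : ℝ) : ℂ) := by
    rw [integral_fun_snd (fun a : ℝ => ((a ^ 2 : ℝ) : ℂ)), integral_complex_ofReal,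
      integral_sq_gaussianReal_zero]
    simp
  have hcross : ∫ p : ℝ × ℝ, (p.1 : ℂ) * (p.2 : ℂ) ∂(g.prod g) = 0 := by
    rw [integral_prod_mul (fun a : ℝ => (a : ℂ)) (fun a : ℝ => (a : ℂ)), integral_complex_ofReal]
    simp [g]
  constructor
  · rw [circularGaussian, integral_map (by fun_prop) (by fun_prop)]
    have : ∀ p : ℝ × ℝ, ((p.1 : ℂ) + (p.2 : ℂ) * Complex.I) * ((p.1 : ℂ) + (p.2 : ℂ) * Complex.I) =
        ((p.1 ^ 2 : ℝ) : ℂ) - ((p.2 ^ 2 : ℝ) : ℂ) + (p.1 : ℂ) * (p.2 : ℂ) * (2 * Complex.I) := by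
      intro p
      push_cast
      linear_combination (p.2 : ℂ) ^ 2 * Complex.I_mul_I
    simp only [this]
    have hsub : Integrable (fun p : ℝ × ℝ => ((p.1 ^ 2 : ℝ) : ℂ) - ((p.2 ^ 2 : ℝ) : ℂ))
        (g.prod g) := (hsq.comp_fst _).sub (hsq.comp_snd _)
    rw [integral_add hsub ((h1.mul_prod h1).mul_const _),
      integral_sub (hsq.comp_fst _) (hsq.comp_snd _), integral_mul_const, hfst, hsnd, hcross]
    simp
  · rw [circularGaussian, integral_map (by fun_prop) (by fun_prop)]
    have : ∀ p : ℝ × ℝ, ((p.1 : ℂ) + (p.2 : ℂ) * Complex.I) *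
        star ((p.1 : ℂ) + (p.2 : ℂ) * Complex.I) = ((p.1 ^ 2 : ℝ) : ℂ) + ((p.2 ^ 2 : ℝ) : ℂ) := by
      intro p
      rw [Complex.star_def, Complex.mul_conj, Complex.normSq_add_mul_I]
      push_cast
      rfl
    simp only [this]
    rw [integral_add (hsq.comp_fst _) (hsq.comp_snd _), hfst, hsnd]
    push_cast
    ring

section Gaussian

variable [Fintype ι] {v : ℝ≥0} {X : Ω → ι → ℂ}

theorem squareIntegrable_of_hasLaw (hX : HasLaw X (circularGaussianVec ι v) P) :
    SquareIntegrable P X := by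
  intro i
  have h := (memLp_id_circularGaussian v).comp_measurePreserving
    (measurePreserving_eval (fun _ : ι => circularGaussian v) i)
  have h' : MemLp (fun z : ι → ℂ => z i) 2 (P.map X) := by rw [hX.map_eq]; exact h
  exact (memLp_map_measure_iff h'.aestronglyMeasurable hX.aemeasurable).mp h'

theorem integral_eval_circularGaussianVec (i : ι) {f : ℂ → ℂ} (hf : Measurable f) :
    ∫ z, f (z i) ∂(circularGaussianVec ι v) = ∫ z, f z ∂(circularGaussian v) :=
  integral_comp_eval hf.aestronglyMeasurable

theorem integral_eval_mul_eval_circularGaussianVec {i j : ι} (hij : i ≠ j) {f g : ℂ → ℂ}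
    (hf : Measurable f) (hg : Measurable g) :
    ∫ z, f (z i) * g (z j) ∂(circularGaussianVec ι v) =
      (∫ z, f z ∂(circularGaussian v)) * ∫ z, g z ∂(circularGaussian v) := by
  have hind : iIndepFun (fun (i : ι) (z : ι → ℂ) => z i) (circularGaussianVec ι v) :=
    iIndepFun_pi (X := fun _ => id) fun _ => aemeasurable_id
  have h := ((hind.indepFun hij).comp hf hg).integral_fun_mul_eq_mul_integral
    (hf.comp (measurable_pi_apply i)).aestronglyMeasurable
    (hg.comp (measurable_pi_apply j)).aestronglyMeasurable
  simp only [Function.comp_apply] at h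
  rw [h, integral_eval_circularGaussianVec i hf, integral_eval_circularGaussianVec j hg]

theorem secondMoment_self_of_hasLaw [DecidableEq ι]
    (hX : HasLaw X (circularGaussianVec ι v) P) :
    secondMoment P X X = (v : ℂ) • (1 : Matrix ι ι ℂ) := by
  ext i j
  have h : secondMoment P X X i j = ∫ z, z i * star (z j) ∂(circularGaussianVec ι v) :=
    hX.integral_comp (f := fun z : ι → ℂ => z i * star (z j)) (by fun_prop)
  rw [h, Matrix.smul_apply, Matrix.one_apply]
  split_ifs with hij
  · subst hij
    rw [integral_eval_circularGaussianVec i (f := fun z : ℂ => z * star z) (by fun_prop),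
      (integral_mul_circularGaussian v).2]
    simp
  · rw [integral_eval_mul_eval_circularGaussianVec hij (f := fun z => z) measurable_id
      (by fun_prop : Measurable fun z : ℂ => star z), integral_circularGaussian]
    simp

/-- This is circularity, `𝔼[X Xᵀ] = 0`. It makes `K₁ n` and `K₂ n*` uncorrelated although both are
functions of the same noise. -/
theorem secondMoment_conjVec_self_of_hasLaw (hX : HasLaw X (circularGaussianVec ι v) P) :
    secondMoment P X (conjVec X) = 0 := by
  ext i j
  have h : secondMoment P X (conjVec X) i j = ∫ z, z i * z j ∂(circularGaussianVec ι v) := by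
    simp only [secondMoment, conjVec, Matrix.of_apply, star_star]
    exact hX.integral_comp (f := fun z : ι → ℂ => z i * z j) (by fun_prop)
  rw [h, Matrix.zero_apply]
  by_cases hij : i = j
  · subst hij
    rw [integral_eval_circularGaussianVec i (f := fun z : ℂ => z * z) (by fun_prop),
      (integral_mul_circularGaussian v).1]
  · rw [integral_eval_mul_eval_circularGaussianVec hij (f := fun z => z) (g := fun z => z)
      measurable_id measurable_id, integral_circularGaussian]
    simp

end Gaussian

end CellFree

/-! ### Covariances of sums of uncorrelated vectors. -/

namespace CellFree

section UncorrelatedSums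

variable {Ω ι κ : Type*} [MeasurableSpace Ω] {P : Measure Ω}

theorem secondMoment_add_self {U W : Ω → ι → ℂ} (hU : SquareIntegrable P U)
    (hW : SquareIntegrable P W) (h : secondMoment P U W = 0) :
    secondMoment P (fun ω => U ω + W ω) (fun ω => U ω + W ω) =
      secondMoment P U U + secondMoment P W W := by
  rw [secondMoment_add_left hU hW (hU.add hW), secondMoment_add_right hU hU hW,
    secondMoment_add_right hW hU hW, h, secondMoment_swap_eq_zero h, add_zero, zero_add]

variable {α : Type*} {β : α → Type*} [∀ a, Fintype (β a)] {X : ∀ a, Ω → β a → ℂ}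
  {s : Finset α} (A : ∀ a, Matrix ι (β a) ℂ)

theorem secondMoment_sum_mulVec_eq_zero (hX : ∀ a, SquareIntegrable P (X a)) {Y : Ω → κ → ℂ}
    (hY : SquareIntegrable P Y) (h : ∀ a ∈ s, secondMoment P (X a) Y = 0) :
    secondMoment P (fun ω => ∑ a ∈ s, A a *ᵥ X a ω) Y = 0 := by
  rw [secondMoment_sum_left (X := fun a ω => A a *ᵥ X a ω) (fun a _ => (hX a).mulVec _) hY]
  refine Finset.sum_eq_zero fun a ha => ?_
  rw [secondMoment_mulVec_left (hX a) hY, h a ha, Matrix.mul_zero]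

/-- Pythagoras: pairwise uncorrelated summands contribute only their own covariances. -/
theorem secondMoment_sum_mulVec_self [∀ a, DecidableEq (β a)]
    (hX : ∀ a, SquareIntegrable P (X a))
    (hself : ∀ a, secondMoment P (X a) (X a) = 1)
    (h : ∀ a a', a ≠ a' → secondMoment P (X a) (X a') = 0) :
    secondMoment P (fun ω => ∑ a ∈ s, A a *ᵥ X a ω) (fun ω => ∑ a ∈ s, A a *ᵥ X a ω) =
      ∑ a ∈ s, A a * (A a)ᴴ := by
  classical
  induction s using Finset.induction_on with
  | empty => ext i j; simp [secondMoment]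
  | insert a s ha ih =>
    simp only [Finset.sum_insert ha]
    have hs : SquareIntegrable P (fun ω => ∑ a ∈ s, A a *ᵥ X a ω) :=
      SquareIntegrable.sum (X := fun a ω => A a *ᵥ X a ω) fun a _ => (hX a).mulVec _
    rw [secondMoment_add_self ((hX a).mulVec _) hs, ih,
      secondMoment_mulVec_mulVec (hX a) (hX a), hself, Matrix.mul_one]
    refine secondMoment_swap_eq_zero (secondMoment_sum_mulVec_eq_zero A hX ((hX a).mulVec _) ?_)
    intro a' ha'
    rw [secondMoment_mulVec_right (hX a') (hX a), h a' a (by rintro rfl; exact ha ha'),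
      Matrix.zero_mul]

end UncorrelatedSums

/-! ### The Gaussian lower bound for the mutual information of a linear channel -/

section LinearChannel

variable {Ω ι κ : Type*} [MeasurableSpace Ω] {P : Measure Ω}
  [Fintype ι] [DecidableEq ι] [Fintype κ]

theorem posDef_one_add_conjTranspose_mul_mul {N : Matrix κ κ ℂ} (hN : N.PosDef)
    (A : Matrix κ ι ℂ) : (1 + Aᴴ * N * A).PosDef :=
  Matrix.PosDef.one.add_posSemidef (hN.posSemidef.conjTranspose_mul_mul_same A)

theorem sum_norm_sq_eq_re_dotProduct (z : ι → ℂ) :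
    ∑ i, ‖z i‖ ^ 2 = (star z ⬝ᵥ ((1 : Matrix ι ι ℂ) *ᵥ z)).re := by
  rw [Matrix.one_mulVec, dotProduct, Complex.re_sum]
  refine Finset.sum_congr rfl fun i _ => ?_
  rw [Pi.star_apply, ← Complex.normSq_eq_norm_sq, Complex.star_def, mul_comm, Complex.mul_conj,
    Complex.ofReal_re]

variable [DecidableEq κ]

/-- The error of the linear minimum mean square error estimate of `X` from `A X + W`, with error
covariance the inverse of `1 + Aᴴ J⁻¹ A`. -/
theorem secondMoment_lmmse_error {X : Ω → ι → ℂ} {W : Ω → κ → ℂ} {J : Matrix κ κ ℂ}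
    (A : Matrix κ ι ℂ) (hX : SquareIntegrable P X) (hW : SquareIntegrable P W)
    (hXX : secondMoment P X X = 1) (hXW : secondMoment P X W = 0)
    (hWW : secondMoment P W W = J) (hJ : J.PosDef)
    {M : Matrix ι ι ℂ} (hM : M = 1 + Aᴴ * J⁻¹ * A)
    {Z : Ω → ι → ℂ} (hZ : ∀ ω, Z ω = X ω - (M⁻¹ * Aᴴ * J⁻¹) *ᵥ (A *ᵥ X ω + W ω)) :
    SquareIntegrable P Z ∧ secondMoment P Z Z = M⁻¹ := by
  have hMpos : M.PosDef := hM ▸ posDef_one_add_conjTranspose_mul_mul hJ.inv A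
  have hMdet : IsUnit M.det := (Matrix.isUnit_iff_isUnit_det _).mp hMpos.isUnit
  have hJdet : IsUnit J.det := (Matrix.isUnit_iff_isUnit_det _).mp hJ.isUnit
  have hG : Aᴴ * J⁻¹ * A = M - 1 := by rw [hM]; abel
  -- As `M⁻¹ Aᴴ J⁻¹ A = M⁻¹ (M - 1) = 1 - M⁻¹`, the error splits into a multiple of `X` and a
  -- multiple of `W`, which are uncorrelated.
  have hZ' : Z = fun ω => M⁻¹ *ᵥ X ω + (-(M⁻¹ * Aᴴ * J⁻¹)) *ᵥ W ω := by
    funext ω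
    have hcoef : M⁻¹ * Aᴴ * J⁻¹ * A = 1 - M⁻¹ := by
      rw [Matrix.mul_assoc, Matrix.mul_assoc, ← Matrix.mul_assoc Aᴴ, hG, Matrix.mul_sub,
        Matrix.nonsing_inv_mul _ hMdet, Matrix.mul_one]
    rw [hZ, Matrix.mulVec_add, Matrix.mulVec_mulVec, hcoef, Matrix.sub_mulVec, Matrix.one_mulVec,
      Matrix.neg_mulVec]
    abel
  have hJh : (J⁻¹)ᴴ = J⁻¹ := hJ.inv.isHermitian
  have hMh : (M⁻¹)ᴴ = M⁻¹ := hMpos.inv.isHermitian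
  rw [hZ']
  refine ⟨(hX.mulVec _).add (hW.mulVec _), ?_⟩
  rw [secondMoment_add_self (hX.mulVec _) (hW.mulVec _)
      (by rw [secondMoment_mulVec_mulVec hX hW, hXW, Matrix.mul_zero, Matrix.zero_mul]),
    secondMoment_mulVec_mulVec hX hX, secondMoment_mulVec_mulVec hW hW, hXX, hWW, Matrix.mul_one,
    Matrix.conjTranspose_neg, Matrix.neg_mul, Matrix.neg_mul, Matrix.mul_neg, neg_neg,
    Matrix.conjTranspose_mul, Matrix.conjTranspose_mul, Matrix.conjTranspose_conjTranspose, hJh,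
    hMh]
  -- The two covariances are `M⁻¹ M⁻¹` and `M⁻¹ (M - 1) M⁻¹`, with sum `M⁻¹`.
  have : M⁻¹ * Aᴴ * J⁻¹ * J * (J⁻¹ * (A * M⁻¹)) = M⁻¹ * (Aᴴ * J⁻¹ * A) * M⁻¹ := by
    rw [Matrix.mul_assoc _ J⁻¹ J, Matrix.nonsing_inv_mul _ hJdet, Matrix.mul_one]
    simp only [Matrix.mul_assoc]
  rw [this, hG, ← Matrix.add_mul, Matrix.mul_sub, Matrix.nonsing_inv_mul _ hMdet, Matrix.mul_one,
    add_sub_cancel, Matrix.one_mul]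

/-- **Worst-case noise bound**: for `X ∼ CN(0, I)` and noise `W` which is uncorrelated with `X` and
has covariance `J`, the mutual information of `X` and `A X + W` is at least
`log₂ det (I + Aᴴ J⁻¹ A)`. -/
theorem ofReal_logb_det_le_mutualInfoLaw [IsProbabilityMeasure P] {X : Ω → ι → ℂ} {W : Ω → κ → ℂ} {J : Matrix κ κ ℂ}
    (A : Matrix κ ι ℂ) (hX : HasLaw X (circularGaussianVec ι 1) P) (hW : SquareIntegrable P W)
    (hXW : secondMoment P X W = 0) (hWW : secondMoment P W W = J) (hJ : J.PosDef) :
    ENNReal.ofReal (Real.logb 2 (1 + Aᴴ * J⁻¹ * A).det.re) ≤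
      mutualInfoLaw (P.map fun ω => (X ω, A *ᵥ X ω + W ω)) := by
  obtain ⟨M, hM⟩ : ∃ M : Matrix ι ι ℂ, M = 1 + Aᴴ * J⁻¹ * A := ⟨_, rfl⟩
  have hMpos : M.PosDef := hM ▸ posDef_one_add_conjTranspose_mul_mul hJ.inv A
  have hMdet : IsUnit M.det := (Matrix.isUnit_iff_isUnit_det _).mp hMpos.isUnit
  have hXsq := squareIntegrable_of_hasLaw hX
  have hXX : secondMoment P X X = 1 := by
    rw [secondMoment_self_of_hasLaw hX, NNReal.coe_one, Complex.ofReal_one, one_smul]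
  obtain ⟨hZsq, hZZ⟩ := secondMoment_lmmse_error A hXsq hW hXX hXW hWW hJ hM (fun _ => rfl)
  have hYsq : SquareIntegrable P fun ω => A *ᵥ X ω + W ω := (hXsq.mulVec A).add hW
  rw [← hM]
  set B := M⁻¹ * Aᴴ * J⁻¹
  set Y : Ω → κ → ℂ := fun ω => A *ᵥ X ω + W ω
  -- Log-density of `CN(B y, M⁻¹)` relative to `CN(0, I)`; the powers of `π` cancel. Being
  -- quadratic, its mean sees only second moments.
  set f : (ι → ℂ) × (κ → ℂ) → ℝ := fun p =>
    Real.log M.det.re - (star (p.1 - B *ᵥ p.2) ⬝ᵥ (M *ᵥ (p.1 - B *ᵥ p.2))).re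
      + ∑ i, ‖p.1 i‖ ^ 2 with hf
  have hfm : Measurable f := by
    have hc : Continuous f := by
      simp only [hf, dotProduct, Matrix.mulVec]
      fun_prop
    exact hc.measurable
  have hXY : AEMeasurable (fun ω => (X ω, Y ω)) P := hX.aemeasurable.prodMk hYsq.aemeasurable
  have hqZ := (integrable_quadraticForm hZsq M).re
  have hqX := (integrable_quadraticForm hXsq 1).re
  have hfXY : (fun ω => f (X ω, Y ω)) = fun ω => Real.log M.det.re
      - (star (X ω - B *ᵥ Y ω) ⬝ᵥ (M *ᵥ (X ω - B *ᵥ Y ω))).re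
      + (star (X ω) ⬝ᵥ ((1 : Matrix ι ι ℂ) *ᵥ X ω)).re := by
    funext ω
    rw [← sum_norm_sq_eq_re_dotProduct]
  have hlogsub := (integrable_const (μ := P) (Real.log M.det.re)).sub hqZ
  have hfint : Integrable f (P.map fun ω => (X ω, Y ω)) := by
    rw [integrable_map_measure hfm.aestronglyMeasurable hXY]
    change Integrable (fun ω => f (X ω, Y ω)) P
    rw [hfXY]
    exact hlogsub.add hqX
  have hre : ∀ {u : Ω → ℂ}, Integrable u P → ∫ ω, (u ω).re ∂P = (∫ ω, u ω ∂P).re :=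
    fun hu => integral_re hu
  have hfval : ∫ p, f p ∂(P.map fun ω => (X ω, Y ω)) = Real.log M.det.re := by
    rw [integral_map hXY hfm.aestronglyMeasurable, hfXY]
    refine (integral_add hlogsub hqX).trans ?_
    have h1 := integral_sub (integrable_const (μ := P) (Real.log M.det.re)) hqZ
    refine (congrArg (· + _) h1).trans ?_
    have h2 := hre (integrable_quadraticForm hZsq M)
    have h3 := hre (integrable_quadraticForm hXsq 1)
    -- Both quadratic forms have mean `tr I`: the first from `M M⁻¹ = I`, the second from `𝔼[X Xᴴ] =
    -- I`. They enter `f` with opposite signs and cancel.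
    rw [integral_quadraticForm hZsq, hZZ, Matrix.mul_nonsing_inv _ hMdet] at h2
    rw [integral_quadraticForm hXsq, hXX, Matrix.mul_one] at h3
    simp only [RCLike.re_eq_complex_re]
    rw [h2, h3]
    simp
  have hprob : IsProbabilityMeasure (P.map fun ω => (X ω, Y ω)) :=
    Measure.isProbabilityMeasure_map hXY
  have hfexp : ∫⁻ p, ENNReal.ofReal (Real.exp (f p))
      ∂((P.map fun ω => (X ω, Y ω)).fst.prod (P.map fun ω => (X ω, Y ω)).snd) = 1 := by
    -- Integrating over `x` first, with `y` fixed, gives one for every centre `B y`, so the law of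
    -- `Y` plays no role.
    rw [lintegral_prod_symm _ (by fun_prop), Measure.fst_map_prodMk₀ hYsq.aemeasurable, hX.map_eq]
    simp only [hf, lintegral_gaussian_density_ratio hMpos]
    simp
  have hkl := InformationTheory.ofReal_integral_le_klDiv hfm hfint hfexp
  rw [hfval] at hkl
  rw [mutualInfoLaw, Real.logb, ENNReal.ofReal_div_of_pos (Real.log_pos one_lt_two)]
  exact ENNReal.div_le_div_right hkl _

end LinearChannel

/-! ### Conditional laws of functions of independent variables -/

/-- By independence `(Z, U)` has a product law, so the kernel sending `z` to the law of `F (z, U)`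
disintegrates the law of `(Z, F (Z, U))`. Conditional distributions are almost everywhere unique,
hence `Z` may be frozen at its value. -/
theorem condDistrib_comp_of_indepFun {Ω γ δ E : Type*} [MeasurableSpace Ω] {P : Measure Ω}
    [IsProbabilityMeasure P] [MeasurableSpace γ] [MeasurableSpace δ] [MeasurableSpace E]
    [StandardBorelSpace E] [Nonempty E] {Z : Ω → γ} {U : Ω → δ} (hZ : AEMeasurable Z P)
    (hU : AEMeasurable U P) (hind : IndepFun Z U P) {F : γ × δ → E} (hF : Measurable F) :
    ∀ᵐ z ∂(P.map Z), condDistrib (fun ω => F (Z ω, U ω)) Z P z =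
      P.map fun ω => F (z, U ω) := by
  have := Measure.isProbabilityMeasure_map hU
  have := Measure.isProbabilityMeasure_map hZ
  set κ : Kernel γ E := (Kernel.id ×ₖ Kernel.const γ (P.map U)).map F
  have hκ : ∀ z, κ z = P.map fun ω => F (z, U ω) := by
    intro z
    rw [Kernel.map_apply _ hF, Kernel.prod_apply, Kernel.id_apply, Kernel.const_apply,
      Measure.dirac_prod, Measure.map_map hF (by fun_prop),
      AEMeasurable.map_map_of_aemeasurable (by fun_prop) hU]
    rfl
  have : IsMarkovKernel κ := Kernel.IsMarkovKernel.map _ hF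
  have hmain := condDistrib_ae_eq_of_measure_eq_compProd (μ := P) (κ := κ) Z
    (Y := fun ω => F (Z ω, U ω)) (hF.comp_aemeasurable (hZ.prodMk hU)) (by
      have hG : Measurable fun p : γ × δ => (p.1, F p) := by fun_prop
      have hmap : P.map (fun ω => (Z ω, F (Z ω, U ω))) =
          ((P.map Z).prod (P.map U)).map fun p => (p.1, F p) := by
        rw [← (indepFun_iff_map_prod_eq_prod_map_map hZ hU).mp hind,
          AEMeasurable.map_map_of_aemeasurable hG.aemeasurable (hZ.prodMk hU)]
        rfl
      rw [hmap]
      -- Tested against `g`, both measures give the iterated integral of `g (z, F (z, u))` over the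
      -- laws of `Z` and `U`.
      refine Measure.ext_of_lintegral _ fun g hg => ?_
      rw [lintegral_map hg hG, lintegral_prod _ (by fun_prop), Measure.lintegral_compProd hg]
      refine lintegral_congr fun z => ?_
      have hFz : AEMeasurable (fun ω => F (z, U ω)) P :=
        (hF.comp measurable_prodMk_left).comp_aemeasurable hU
      rw [hκ, lintegral_map' (by fun_prop) hU, lintegral_map' (by fun_prop) hFz])
  filter_upwards [hmain] with z hz
  rw [hz, hκ]

end CellFree

/-! ### Hardware matrices and positivity of `J`. -/

namespace CellFree

theorem conjMat_conjTranspose {m n : Type*} (A : Matrix m n ℂ) : (conjMat A)ᴴ = Aᵀ := by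
  ext i j
  simp [conjMat]

namespace IQImbalance

variable {C K Nr Nt S : ℕ} (q : IQImbalance C K Nr Nt)

/-- The blocks are themselves diagonal, so positivity of the noise covariance becomes a scalar
question for each antenna. -/
theorem K₁_eq_diagonal : q.K₁ = Matrix.diagonal fun p => q.K₁c p.1 p.2 p.2 := by
  ext p p'
  rw [K₁, Matrix.of_apply, Matrix.diagonal_apply]
  by_cases h : p = p'
  · subst h
    simp
  · rw [if_neg h]
    split_ifs with h1
    · have h2 : p.2 ≠ p'.2 := fun h2 => h (Prod.ext h1 h2)
      simp [K₁c, h2]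
    · rfl

theorem K₂_eq_diagonal : q.K₂ = Matrix.diagonal fun p => 1 - star (q.K₁c p.1 p.2 p.2) := by
  rw [K₂, K₁_eq_diagonal, conjMat, Matrix.diagonal_map (star_zero _), ← Matrix.diagonal_one,
    Matrix.diagonal_sub]

/-- The covariance of the receiver noise distorted by the I/Q imbalance is positive definite. -/
theorem posDef_noise {v : ℝ} (hv : 0 < v) :
    ((v : ℂ) • (q.K₁ * q.K₁ᴴ) + (v : ℂ) • (q.K₂ * q.K₂ᴴ)).PosDef := by
  rw [K₁_eq_diagonal, K₂_eq_diagonal, Matrix.diagonal_conjTranspose, Matrix.diagonal_conjTranspose,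
    Matrix.diagonal_mul_diagonal, Matrix.diagonal_mul_diagonal, ← smul_add, Matrix.diagonal_add]
  refine Matrix.PosDef.smul (Matrix.PosDef.diagonal fun p => ?_) (by exact_mod_cast hv)
  obtain ⟨d, hd⟩ : ∃ d, d = q.K₁c p.1 p.2 p.2 := ⟨_, rfl⟩
  simp only [Pi.star_apply, ← hd]
  rw [Complex.star_def, Complex.mul_conj, Complex.mul_conj, ← Complex.ofReal_add, Complex.zero_lt_real]
  -- The entries of `K₁` and `K₂` at one antenna are `d` and `1 - d*`, which cannot both vanish;
  -- hence no mismatch can make the noise covariance singular.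
  by_cases h0 : d = 0
  · simp [h0]
  · exact add_pos_of_pos_of_nonneg (Complex.normSq_pos.mpr h0) (Complex.normSq_nonneg _)

variable {b : Fin K → ℕ} (𝒦 : Subcarrier S → Finset (Fin K)) {σ : ℝ≥0} (k : Fin K)
  (s : Subcarrier S) (h : Channels C K Nr Nt S)
  (V : ∀ i : Fin K, Subcarrier S → Matrix (Fin Nt) (Fin (b i)) ℂ)

/-- Each signal term becomes a Gram matrix `A Aᴴ`, which shows positive semidefiniteness and is the
form in which the covariance of the disturbance is computed. -/
theorem J_eq : q.J 𝒦 σ k s h V =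
    ∑ i ∈ (𝒦 s).erase k, (q.P₁ h i s * V i s) * (q.P₁ h i s * V i s)ᴴ
      + (∑ i ∈ 𝒦 s, (q.P₂ h i s * conjMat (V i (-s))) * (q.P₂ h i s * conjMat (V i (-s)))ᴴ)
      + ((((σ ^ 2 : ℝ≥0) : ℝ) : ℂ) • (q.K₁ * q.K₁ᴴ)
      + (((σ ^ 2 : ℝ≥0) : ℝ) : ℂ) • (q.K₂ * q.K₂ᴴ)) := by
  simp only [J, Matrix.conjTranspose_mul, conjMat_conjTranspose, Matrix.mul_assoc, NNReal.coe_pow,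
    Complex.ofReal_pow]
  abel

theorem posDef_J (hσ : 0 < σ) : (q.J 𝒦 σ k s h V).PosDef := by
  rw [J_eq, add_comm]
  refine (q.posDef_noise (by positivity)).add_posSemidef (.add ?_ ?_) <;>
  exact Matrix.posSemidef_sum _ fun i _ => Matrix.posSemidef_self_mul_conjTranspose _

theorem rateMatrix_eq : q.rateMatrix 𝒦 σ k s h V =
    1 + (q.P₁ h k s * V k s)ᴴ * (q.J 𝒦 σ k s h V)⁻¹ * (q.P₁ h k s * V k s) := by
  simp only [rateMatrix, Matrix.conjTranspose_mul, Matrix.mul_assoc]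

theorem posDef_rateMatrix (hσ : 0 < σ) : (q.rateMatrix 𝒦 σ k s h V).PosDef := by
  rw [rateMatrix_eq]
  exact posDef_one_add_conjTranspose_mul_mul (q.posDef_J 𝒦 k s h V hσ).inv _

/-! ### The disturbance for a fixed channel. -/

section FixedChannel

variable {Ω : Type*}
  (x : ∀ i : Fin K, Subcarrier S → Ω → Fin (b i) → ℂ) (n : Ω → Fin C × Fin Nr → ℂ)

/-- Everything in the received signal except the useful signal of UE `k`. -/
noncomputable def disturbance (ω : Ω) : Fin C × Fin Nr → ℂ :=
  ∑ i ∈ (𝒦 s).erase k, (q.P₁ h i s * V i s) *ᵥ x i s ω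
    + ∑ i ∈ 𝒦 s, (q.P₂ h i s * conjMat (V i (-s))) *ᵥ conjVec (x i (-s)) ω
    + (q.K₁ *ᵥ n ω + q.K₂ *ᵥ conjVec n ω)

theorem received_eq_add_disturbance (hk : k ∈ 𝒦 s) (ω : Ω) :
    q.received 𝒦 s h V (fun i t => x i t ω) (n ω) =
      (q.P₁ h k s * V k s) *ᵥ x k s ω + q.disturbance 𝒦 k s h V x n ω := by
  rw [received, ← Finset.add_sum_erase _ _ hk, disturbance]
  simp only [add_assoc]
  rfl

variable {x n} [MeasurableSpace Ω] {P : Measure Ω}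
  (hx : ∀ i t, HasLaw (x i t) (circularGaussianVec (Fin (b i)) 1) P)
  (hxx : ∀ t i l, i ≠ l → Uncorrelated P (x i t) (x l t))
  (hmirror : ∀ i ∈ 𝒦 s, ∀ l ∈ 𝒦 s, Uncorrelated P (x i s) (conjVec (x l (-s))))
  (hn : HasLaw n (circularGaussianVec (Fin C × Fin Nr) (σ ^ 2)) P)
  (hxn : ∀ i ∈ 𝒦 s, ∀ t, t = s ∨ t = -s →
    Uncorrelated P (x i t) n ∧ Uncorrelated P (x i t) (conjVec n))
include hx hxx hmirror hn hxn

/-- The disturbance consists of interference `I`, cross-talk `T` and distorted noise `N`. These are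
pairwise uncorrelated and uncorrelated with the useful symbols, so the covariance is the sum of
three covariances, matching the three groups of `J_eq`. -/
theorem secondMoment_disturbance (hk : k ∈ 𝒦 s) :
    SquareIntegrable P (q.disturbance 𝒦 k s h V x n) ∧
    secondMoment P (x k s) (q.disturbance 𝒦 k s h V x n) = 0 ∧
    secondMoment P (q.disturbance 𝒦 k s h V x n) (q.disturbance 𝒦 k s h V x n) =
      q.J 𝒦 σ k s h V := by
  have hxs : ∀ i t, SquareIntegrable P (x i t) := fun i t => squareIntegrable_of_hasLaw (hx i t)
  have hxc : ∀ i t, SquareIntegrable P (conjVec (x i t)) := fun i t => (hxs i t).conjVec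
  have hns : SquareIntegrable P n := squareIntegrable_of_hasLaw hn
  have hnc := hns.conjVec
  have hself : ∀ i t, secondMoment P (x i t) (x i t) = 1 := fun i t => by
    rw [secondMoment_self_of_hasLaw (hx i t), NNReal.coe_one, Complex.ofReal_one, one_smul]
  have hconj : ∀ {ι κ : Type} {X : Ω → ι → ℂ} {Y : Ω → κ → ℂ}, secondMoment P X Y = 0 →
      secondMoment P (conjVec X) (conjVec Y) = 0 := fun h0 => by
    rw [secondMoment_conjVec_conjVec, h0]
    exact Matrix.map_zero _ (star_zero _)
  have hcc : ∀ {κ : Type} (Y : Ω → κ → ℂ), conjVec (conjVec Y) = Y := fun Y => by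
    funext ω i
    simp [conjVec]
  set I : Ω → Fin C × Fin Nr → ℂ := fun ω =>
    ∑ i ∈ (𝒦 s).erase k, (q.P₁ h i s * V i s) *ᵥ x i s ω
  set T : Ω → Fin C × Fin Nr → ℂ := fun ω =>
    ∑ i ∈ 𝒦 s, (q.P₂ h i s * conjMat (V i (-s))) *ᵥ conjVec (x i (-s)) ω
  set N : Ω → Fin C × Fin Nr → ℂ := fun ω => q.K₁ *ᵥ n ω + q.K₂ *ᵥ conjVec n ω
  have hI : SquareIntegrable P I :=
    .sum (X := fun i ω => (q.P₁ h i s * V i s) *ᵥ x i s ω) fun i _ => (hxs i s).mulVec _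
  have hT : SquareIntegrable P T :=
    .sum (X := fun i ω => (q.P₂ h i s * conjMat (V i (-s))) *ᵥ conjVec (x i (-s)) ω)
      fun i _ => (hxc i (-s)).mulVec _
  have hN : SquareIntegrable P N := (hns.mulVec _).add (hnc.mulVec _)
  have hright : ∀ {κ : Type} {Y : Ω → κ → ℂ}, SquareIntegrable P Y →
      secondMoment P Y n = 0 → secondMoment P Y (conjVec n) = 0 → secondMoment P Y N = 0 := by
    intro κ Y hY h1 h2
    rw [secondMoment_add_right hY (hns.mulVec _) (hnc.mulVec _), secondMoment_mulVec_right hY hns,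
      secondMoment_mulVec_right hY hnc, h1, h2, Matrix.zero_mul, Matrix.zero_mul, add_zero]
  have hxN : ∀ i ∈ 𝒦 s, secondMoment P (x i s) N = 0 := fun i hi =>
    hright (hxs i s) (hxn i hi s (.inl rfl)).1.secondMoment_eq_zero
      (hxn i hi s (.inl rfl)).2.secondMoment_eq_zero
  have hcN : ∀ i ∈ 𝒦 s, secondMoment P (conjVec (x i (-s))) N = 0 := fun i hi => by
    -- Conjugating the symbols exchanges the two noise hypotheses: `𝔼[x* nᴴ]` is the conjugate of
    -- `𝔼[x nᵀ]`, and `𝔼[x* nᵀ]` that of `𝔼[x nᴴ]`.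
    obtain ⟨h1, h2⟩ := hxn i hi (-s) (.inr rfl)
    refine hright (hxc i (-s)) ?_ (hconj h1.secondMoment_eq_zero)
    simpa only [hcc] using hconj h2.secondMoment_eq_zero
  have hxT : ∀ i ∈ 𝒦 s, secondMoment P (x i s) T = 0 := fun i hi =>
    secondMoment_swap_eq_zero (secondMoment_sum_mulVec_eq_zero _ (fun l => hxc l (-s)) (hxs i s)
      fun l hl => secondMoment_swap_eq_zero (hmirror i hi l hl).secondMoment_eq_zero)
  have hIN : secondMoment P I N = 0 :=
    secondMoment_sum_mulVec_eq_zero _ (fun l => hxs l s) hN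
      fun l hl => hxN l (Finset.mem_of_mem_erase hl)
  have hIT : secondMoment P I T = 0 :=
    secondMoment_sum_mulVec_eq_zero _ (fun l => hxs l s) hT
      fun l hl => hxT l (Finset.mem_of_mem_erase hl)
  have hTN : secondMoment P T N = 0 :=
    secondMoment_sum_mulVec_eq_zero _ (fun l => hxc l (-s)) hN hcN
  have hxI : secondMoment P (x k s) I = 0 :=
    secondMoment_swap_eq_zero (secondMoment_sum_mulVec_eq_zero _ (fun l => hxs l s) (hxs k s)
      fun l hl => (hxx s l k (Finset.ne_of_mem_erase hl)).secondMoment_eq_zero)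
  have hD : q.disturbance 𝒦 k s h V x n = fun ω => (I ω + T ω) + N ω := rfl
  rw [hD]
  refine ⟨(hI.add hT).add hN, ?_, ?_⟩
  · rw [secondMoment_add_right (hxs k s) (hI.add hT) hN, secondMoment_add_right (hxs k s) hI hT,
      hxI, hxT k hk, hxN k hk, add_zero, add_zero]
  · rw [secondMoment_add_self (hI.add hT) hN
        (by rw [secondMoment_add_left hI hT hN, hIN, hTN, add_zero]),
      secondMoment_add_self hI hT hIT,
      secondMoment_add_self (hns.mulVec q.K₁) (hnc.mulVec q.K₂)
        (by rw [secondMoment_mulVec_mulVec hns hnc, secondMoment_conjVec_self_of_hasLaw hn,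
          Matrix.mul_zero, Matrix.zero_mul]),
      secondMoment_mulVec_mulVec hns hns, secondMoment_mulVec_mulVec hnc hnc,
      secondMoment_conjVec_conjVec, secondMoment_self_of_hasLaw hn, J_eq,
      secondMoment_sum_mulVec_self _ (fun i => hxs i s) (fun i => hself i s)
        (fun i l hil => (hxx s i l hil).secondMoment_eq_zero),
      secondMoment_sum_mulVec_self _ (fun i => hxc i (-s)) ?_
        (fun i l hil => hconj (hxx (-s) i l hil).secondMoment_eq_zero)]
    · have hone : conjMat ((((σ ^ 2 : ℝ≥0) : ℝ) : ℂ) • (1 : Matrix (Fin C × Fin Nr) (Fin C × Fin Nr) ℂ)) =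
          (((σ ^ 2 : ℝ≥0) : ℝ) : ℂ) • 1 := by
        ext i j
        simp only [conjMat, Matrix.map_apply, Matrix.smul_apply, Matrix.one_apply]
        split_ifs <;> simp
      rw [hone, Matrix.mul_smul, Matrix.mul_smul, Matrix.mul_one, Matrix.mul_one, Matrix.smul_mul,
        Matrix.smul_mul]
    · intro i
      rw [secondMoment_conjVec_conjVec, hself]
      exact Matrix.map_one _ (star_zero _) (star_one _)

/-- For a fixed channel realization the spectral efficiency is a lower bound of the mutual
information. -/
theorem ofReal_SE_le_mutualInfoLaw [IsProbabilityMeasure P] (hσ : 0 < σ) (hk : k ∈ 𝒦 s) :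
    ENNReal.ofReal (q.SE 𝒦 σ k s h V) ≤ mutualInfoLaw
      (P.map fun ω => (x k s ω, q.received 𝒦 s h V (fun i t => x i t ω) (n ω))) := by
  obtain ⟨hsq, h0, hJ⟩ := q.secondMoment_disturbance 𝒦 k s h V hx hxx hmirror hn hxn hk
  simp only [received_eq_add_disturbance q 𝒦 k s h V x n hk, SE, rateMatrix_eq]
  exact ofReal_logb_det_le_mutualInfoLaw _ (hx k s) hsq h0 hJ (q.posDef_J 𝒦 k s h V hσ)

end FixedChannel

/-! ### Measurability and the passage to random channels. -/

/-- The received signal depends measurably on channels, precoders, symbols and noise. -/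
theorem measurable_received {α : Type*} [MeasurableSpace α] {h : α → Channels C K Nr Nt S}
    {V : α → ∀ i : Fin K, Subcarrier S → Matrix (Fin Nt) (Fin (b i)) ℂ}
    {x : α → ∀ i : Fin K, Subcarrier S → Fin (b i) → ℂ} {n : α → Fin C × Fin Nr → ℂ}
    (hh : Measurable h) (hV : Measurable V) (hx : Measurable x) (hn : Measurable n) :
    Measurable fun a => q.received 𝒦 s (h a) (V a) (x a) (n a) := by
  have hh' : ∀ i t p r, Measurable fun a => h a i t p r := fun i t p r =>
    measurable_pi_iff.mp (measurable_pi_iff.mp (measurable_pi_iff.mp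
      (measurable_pi_iff.mp hh i) t) p) r
  have hV' : ∀ i t p r, Measurable fun a => V a i t p r := fun i t p r =>
    measurable_pi_iff.mp (measurable_pi_iff.mp (measurable_pi_iff.mp
      (measurable_pi_iff.mp hV i) t) p) r
  have hx' : ∀ i t p, Measurable fun a => x a i t p := fun i t p =>
    measurable_pi_iff.mp (measurable_pi_iff.mp (measurable_pi_iff.mp hx i) t) p
  have hn' : ∀ p, Measurable fun a => n a p := measurable_pi_iff.mp hn
  refine measurable_pi_iff.mpr fun p => ?_
  simp only [received, P₁, P₂, Pi.add_apply, Finset.sum_apply, Matrix.mulVec, dotProduct,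
    Matrix.mul_apply, Matrix.add_apply, conjMat, Matrix.map_apply, Pi.star_apply]
  fun_prop

end IQImbalance

/-- The effective channels depend measurably on the physical channels and RIS coefficients. -/
theorem measurable_effectiveChannels {α : Type*} [MeasurableSpace α] {C K Q M Nr Nt S : ℕ}
    {G : α → Subcarrier S → Fin C → Fin Q → Matrix (Fin Nr) (Fin M) ℂ}
    {H : α → Subcarrier S → Fin Q → Fin K → Matrix (Fin M) (Fin Nt) ℂ}
    {R : α → Subcarrier S → Fin C → Fin K → Matrix (Fin Nr) (Fin Nt) ℂ}
    {ρ φ : α → Fin Q → Fin M → ℝ}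
    (hG : Measurable G) (hH : Measurable H) (hR : Measurable R)
    (hρ : Measurable ρ) (hφ : Measurable φ) :
    Measurable fun a => effectiveChannels (G a) (H a) (R a) (ρ a) (φ a) := by
  have hG' : ∀ t c j p r, Measurable fun a => G a t c j p r := fun t c j p r =>
    measurable_pi_iff.mp (measurable_pi_iff.mp (measurable_pi_iff.mp (measurable_pi_iff.mp
      (measurable_pi_iff.mp hG t) c) j) p) r
  have hH' : ∀ t c j p r, Measurable fun a => H a t c j p r := fun t c j p r =>
    measurable_pi_iff.mp (measurable_pi_iff.mp (measurable_pi_iff.mp (measurable_pi_iff.mp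
      (measurable_pi_iff.mp hH t) c) j) p) r
  have hR' : ∀ t c j p r, Measurable fun a => R a t c j p r := fun t c j p r =>
    measurable_pi_iff.mp (measurable_pi_iff.mp (measurable_pi_iff.mp (measurable_pi_iff.mp
      (measurable_pi_iff.mp hR t) c) j) p) r
  refine measurable_pi_iff.mpr fun k => measurable_pi_iff.mpr fun t => measurable_pi_iff.mpr
    fun p => measurable_pi_iff.mpr fun r => ?_
  simp only [effectiveChannels, risToAp, risMatrix, vstack, Matrix.add_apply, Matrix.mul_apply,
    Matrix.of_apply, Matrix.diagonal_apply, mul_ite, mul_zero, Finset.sum_ite_eq', Finset.mem_univ,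
    if_true]
  fun_prop

end CellFree


/-- `P` is the probability measure; `G`, `H`, `R` are the random physical channels, `ρ`, `φ` the
(possibly random, for instance channel dependent) RIS amplitudes and phases, `V` the precoders as
functions of the effective channels, `x` the symbols and `n` the receiver noise on subcarrier `s`.
The interference and the cross-talk need not be independent of the symbols of UE `k`, nor jointly
Gaussian with them: they are only assumed uncorrelated. -/
theorem proposition1
    {Ω : Type*} [MeasurableSpace Ω] (P : Measure Ω) [IsProbabilityMeasure P]
    {C K Q M Nr Nt S : ℕ} (b : Fin K → ℕ) (𝒦 : CellFree.Subcarrier S → Finset (Fin K))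
    (q : CellFree.IQImbalance C K Nr Nt)
    (G : Ω → CellFree.Subcarrier S → Fin C → Fin Q → Matrix (Fin Nr) (Fin M) ℂ)
    (H : Ω → CellFree.Subcarrier S → Fin Q → Fin K → Matrix (Fin M) (Fin Nt) ℂ)
    (R : Ω → CellFree.Subcarrier S → Fin C → Fin K → Matrix (Fin Nr) (Fin Nt) ℂ)
    (ρ φ : Ω → Fin Q → Fin M → ℝ)
    (hG : Measurable G) (hH : Measurable H) (hR : Measurable R)
    (hρ : Measurable ρ) (hφ : Measurable φ)
    (Hbar : Ω → CellFree.Channels C K Nr Nt S)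
    (hHbar : ∀ ω, Hbar ω = CellFree.effectiveChannels (G ω) (H ω) (R ω) (ρ ω) (φ ω))
    (V : CellFree.Channels C K Nr Nt S →
      ∀ i : Fin K, CellFree.Subcarrier S → Matrix (Fin Nt) (Fin (b i)) ℂ)
    (hV : Measurable V)
    (k : Fin K) (s : CellFree.Subcarrier S) (hk : k ∈ 𝒦 s)
    (x : ∀ i : Fin K, CellFree.Subcarrier S → Ω → Fin (b i) → ℂ)
    (hx : ∀ i t, HasLaw (x i t) (CellFree.circularGaussianVec (Fin (b i)) 1) P)
    (hxx : ∀ t i l, i ≠ l → CellFree.Uncorrelated P (x i t) (x l t))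
    (hmirror : ∀ i ∈ 𝒦 s, ∀ l ∈ 𝒦 s,
      CellFree.Uncorrelated P (x i s) (CellFree.conjVec (x l (-s))))
    (σ : ℝ≥0) (hσ : 0 < σ) (n : Ω → Fin C × Fin Nr → ℂ)
    (hn : HasLaw n (CellFree.circularGaussianVec (Fin C × Fin Nr) (σ ^ 2)) P)
    (hxn : ∀ i ∈ 𝒦 s, ∀ t, t = s ∨ t = -s →
      CellFree.Uncorrelated P (x i t) n ∧ CellFree.Uncorrelated P (x i t) (CellFree.conjVec n))
    (hind : IndepFun Hbar (fun ω => ((fun i t => x i t ω), n ω)) P)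
    (y : Ω → Fin C × Fin Nr → ℂ)
    (hy : ∀ ω, y ω = q.received 𝒦 s (Hbar ω) (V (Hbar ω)) (fun i t => x i t ω) (n ω)) :
    (∀ h, (q.J 𝒦 σ k s h (V h)).PosDef ∧ (q.rateMatrix 𝒦 σ k s h (V h)).PosDef) ∧
    (∀ᵐ h ∂(P.map Hbar),
      ENNReal.ofReal (q.SE 𝒦 σ k s h (V h)) ≤
        CellFree.mutualInfoGivenValue P (x k s) y Hbar h) ∧
    ∫⁻ h, ENNReal.ofReal (q.SE 𝒦 σ k s h (V h)) ∂(P.map Hbar) ≤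
      CellFree.condMutualInfo P (x k s) y Hbar := by
  have hHm : Measurable Hbar := by
    rw [funext hHbar]
    exact CellFree.measurable_effectiveChannels hG hH hR hρ hφ
  have hU : AEMeasurable (fun ω => ((fun i t => x i t ω), n ω) :
      Ω → (∀ i : Fin K, CellFree.Subcarrier S → Fin (b i) → ℂ) × (Fin C × Fin Nr → ℂ)) P :=
    (aemeasurable_pi_lambda _ fun i => aemeasurable_pi_lambda _ fun t =>
      (hx i t).aemeasurable).prodMk hn.aemeasurable
  have hF : Measurable fun p : CellFree.Channels C K Nr Nt S ×
      ((∀ i : Fin K, CellFree.Subcarrier S → Fin (b i) → ℂ) × (Fin C × Fin Nr → ℂ)) =>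
      (p.2.1 k s, q.received 𝒦 s p.1 (V p.1) p.2.1 p.2.2) := by
    have hxm : Measurable fun p : CellFree.Channels C K Nr Nt S ×
      ((∀ i : Fin K, CellFree.Subcarrier S → Fin (b i) → ℂ) × (Fin C × Fin Nr → ℂ)) => p.2.1 :=
      measurable_fst.comp measurable_snd
    exact (measurable_pi_iff.mp (measurable_pi_iff.mp hxm k) s).prodMk
      (q.measurable_received 𝒦 s measurable_fst (hV.comp measurable_fst) hxm
        (measurable_snd.comp measurable_snd))
  have hae : ∀ᵐ h ∂(P.map Hbar), ENNReal.ofReal (q.SE 𝒦 σ k s h (V h)) ≤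
      CellFree.mutualInfoGivenValue P (x k s) y Hbar h := by
    -- Given `h`, the precoder `V h` is a constant matrix, and symbols and noise keep their
    -- unconditional law under `P`, so the moment hypotheses remain valid and the fixed-channel
    -- bound applies.
    filter_upwards [CellFree.condDistrib_comp_of_indepFun hHm.aemeasurable hU hind hF] with h hh
    rw [CellFree.mutualInfoGivenValue, funext hy, hh]
    exact q.ofReal_SE_le_mutualInfoLaw 𝒦 k s h (V h) hx hxx hmirror hn hxn hσ hk
  exact ⟨fun h => ⟨q.posDef_J 𝒦 k s h (V h) hσ, q.posDef_rateMatrix 𝒦 k s h (V h) hσ⟩, hae,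
    lintegral_mono_ae hae⟩
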